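/- Let $X$ be a metrizable continuum (a non-empty compact connected metrizable space) that is indecomposable, i.e. $X$ is not the union of two proper subcontinua. Let $\mathfrak K(\aleph_0)$ be the class of all topological spaces having at most countably many connected components. Then: (a) $X$ is a Mazurkiewicz $\mathfrak K(\aleph_0)$-manifold: for any two disjoint closed sets $X_0, X_1\subset X$ with non-empty interiors in $X$, and any sequence $F_0,F_1,F_2,\dots$ of proper closed subsets of $X$ with $F_i\in\mathfrak K(\aleph_0)$ for every $i$, there is a continuum $K\subset X\setminus\bigcup_{i=0}^\infty F_i$ with $K\cap X_0\neq\varnothing\neq K\cap X_1$. (b) $X$ is a strong Cantor $\mathfrak K(\aleph_0)$-manifold in the following sense: $X$ cannot be represented as a union $X=\bigcup_{i=0}^\infty F_i$ of proper closed subsets $F_i\subset X$ such that $F_i\cap F_j\in\mathfrak K(\aleph_0)$ for all $i\neq j$. -/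

import Mathlib

universe u

/-- A subset of a space is a continuum if it is non-empty, compact and connected
(`IsConnected` includes non-emptiness). It is only used in Hausdorff spaces. -/
def IsContinuum {X : Type u} [TopologicalSpace X] (K : Set X) : Prop :=
  IsCompact K ∧ IsConnected K

/-- A continuum `X` is indecomposable if it is not the union of two proper subcontinua. -/
def IsIndecomposable (X : Type u) [TopologicalSpace X] : Prop :=
  ¬ ∃ A B : Set X, IsContinuum A ∧ IsContinuum B ∧
    A ≠ Set.univ ∧ B ≠ Set.univ ∧ A ∪ B = Set.univ

/-- A class of topological spaces. -/
abbrev SpaceClass : Type (u + 1) := ∀ (Y : Type u) [TopologicalSpace Y], Prop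

/-- The class `𝔎(ℵ₀)` of all spaces with at most countably many connected components. -/
def CountablyManyComponents : SpaceClass.{u} :=
  fun Y _ => Countable (ConnectedComponents Y)

/-- A Mazurkiewicz manifold with respect to the class `C`: any two disjoint closed massive
sets (sets with non-empty interior) are joined by a continuum that avoids a given countable
union of proper closed subsets belonging (with the subspace topology) to `C`. -/
def IsMazurkiewiczManifold (C : SpaceClass.{u}) (X : Type u) [TopologicalSpace X] : Prop :=
  ∀ X₀ X₁ : Set X, IsClosed X₀ → IsClosed X₁ → Disjoint X₀ X₁ →
    (interior X₀).Nonempty → (interior X₁).Nonempty →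
    ∀ F : ℕ → Set X, (∀ i, IsClosed (F i) ∧ F i ≠ Set.univ ∧ C (F i)) →
      ∃ K : Set X, IsContinuum K ∧ K ⊆ (⋃ i, F i)ᶜ ∧
        (K ∩ X₀).Nonempty ∧ (K ∩ X₁).Nonempty

/-- A strong Cantor manifold with respect to the class `C`: the space is not the union of a
sequence of proper closed subsets all of whose pairwise intersections (for distinct indices)
belong to `C`. -/
def IsStrongCantorManifold (C : SpaceClass.{u}) (X : Type u) [TopologicalSpace X] : Prop :=
  ¬ ∃ F : ℕ → Set X, (∀ i, IsClosed (F i) ∧ F i ≠ Set.univ) ∧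
    (⋃ i, F i) = Set.univ ∧ ∀ i j, i ≠ j → C (F i ∩ F j : Set X)

open Set Topology

section Continua

variable {X : Type u} [TopologicalSpace X]

/-! In an indecomposable continuum the composants partition the space, and proper subcontinua are
nowhere dense, so by Baire countably many composants never cover. Each component of a proper closed
set lies in one composant; hence some composant misses all the given sets with countably many
components. It is dense, so it joins `X₀` to `X₁`, giving (a). For (b), choose a composant missing
all pairwise intersections. By Sierpiński's theorem each proper subcontinuum through its point `q`
stays in the one `F i` containing `q`, against density. -/

theorem IsContinuum.union {A B : Set X} (hA : IsContinuum A) (hB : IsContinuum B)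
    (h : (A ∩ B).Nonempty) : IsContinuum (A ∪ B) :=
  ⟨hA.1.union hB.1, IsConnected.union h hA.2 hB.2⟩

theorem isContinuum_connectedComponentIn {T : Set X} (hT : IsCompact T) {p : X} (hp : p ∈ T) :
    IsContinuum (connectedComponentIn T p) := by
  refine ⟨?_, isConnected_connectedComponentIn_iff.2 hp⟩
  have := isCompact_iff_compactSpace.1 hT
  rw [connectedComponentIn_eq_image hp]
  exact isClosed_connectedComponent.isCompact.image continuous_subtype_val

/-- In a compact Hausdorff space, a connected component and a closed set disjoint from it are
separated by a clopen set. -/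
theorem exists_isClopen_of_disjoint_connectedComponent {Y : Type*} [TopologicalSpace Y] [T2Space Y]
    [CompactSpace Y] {B : Set Y} (hB : IsClosed B) {p : Y} (h : Disjoint (connectedComponent p) B) :
    ∃ D : Set Y, IsClopen D ∧ p ∈ D ∧ Disjoint D B := by
  rw [connectedComponent_eq_iInter_isClopen] at h
  have : Nonempty { s : Set Y // IsClopen s ∧ p ∈ s } := ⟨⟨univ, isClopen_univ, mem_univ p⟩⟩
  have hdir : Directed (· ⊇ ·) fun s : { s : Set Y // IsClopen s ∧ p ∈ s } => s.val := by
    rintro ⟨s, hs, hxs⟩ ⟨t, ht, hxt⟩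
    exact ⟨⟨s ∩ t, hs.inter ht, ⟨hxs, hxt⟩⟩, inter_subset_left, inter_subset_right⟩
  obtain ⟨⟨D, hD, hpD⟩, hDB⟩ := exists_subset_nhds_of_compactSpace (U := Bᶜ) hdir
    (fun s => s.2.1.1) fun y hy => hB.isOpen_compl.mem_nhds (disjoint_left.1 h hy)
  exact ⟨D, hD, hpD, disjoint_left.2 fun _ hy => hDB hy⟩

/-- Boundary bumping. -/
theorem IsContinuum.exists_mem_connectedComponentIn_closure_compl [T2Space X] {K A : Set X}
    (hK : IsContinuum K) (hA : IsClosed A) {p : X} (hp : p ∈ K ∩ A) (hKA : ¬ K ⊆ A) :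
    ∃ z ∈ connectedComponentIn (K ∩ A) p, z ∈ closure Aᶜ := by
  by_contra! hcon
  have hT : IsCompact (K ∩ A) := hK.1.inter_right hA
  have := isCompact_iff_compactSpace.1 hT
  obtain ⟨D, hD, hpD, hDB⟩ := exists_isClopen_of_disjoint_connectedComponent
    (p := (⟨p, hp⟩ : ↥(K ∩ A))) (B := Subtype.val ⁻¹' closure Aᶜ)
    (isClosed_closure.preimage continuous_subtype_val)
    (disjoint_left.2 fun y hy hyB => hcon y
      (by rw [connectedComponentIn_eq_image hp]; exact mem_image_of_mem _ hy) hyB)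
  have hemb := hT.isClosed.isClosedEmbedding_subtypeVal
  have hD1 : IsClosed (Subtype.val '' D) := hemb.isClosedMap _ hD.1
  have hD2 : IsClosed (Subtype.val '' Dᶜ) := hemb.isClosedMap _ hD.compl.1
  obtain ⟨x, hxK, hxA⟩ := not_subset.1 hKA
  -- `D` misses both the rest of `K ∩ A` and `closure Aᶜ`, so it would split off from the connected
  -- set `K`.
  obtain ⟨y, -, ⟨d, hd, rfl⟩, hy⟩ := isPreconnected_closed_iff.1 hK.2.isPreconnected
    (Subtype.val '' D) (Subtype.val '' Dᶜ ∪ closure Aᶜ) hD1 (hD2.union isClosed_closure)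
    (by
      intro y hy
      by_cases hyA : y ∈ A
      · by_cases hyD : (⟨y, hy, hyA⟩ : ↥(K ∩ A)) ∈ D
        · exact Or.inl ⟨_, hyD, rfl⟩
        · exact Or.inr (Or.inl ⟨_, hyD, rfl⟩)
      · exact Or.inr (Or.inr (subset_closure hyA)))
    ⟨p, hp.1, ⟨_, hpD, rfl⟩⟩ ⟨x, hxK, Or.inr (subset_closure hxA)⟩
  rcases hy with ⟨e, he, hed⟩ | hy
  · exact he (Subtype.val_injective hed ▸ hd)
  · exact disjoint_left.1 hDB hd hy

/-- Inductive step for Sierpiński's theorem. Take `p ∈ K` in `F m`, `m ≠ n`, and an open `U ⊇ K ∩ F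
m` whose closure misses `K ∩ F n`. By boundary bumping the component of `p` in `K ∩ closure U`
leaves `U`, hence `F m`; containing `p`, it lies in no other `F i`. -/
theorem IsContinuum.exists_subset_disjoint_of_iUnion [CompactSpace X] [T2Space X] {K : Set X}
    (hK : IsContinuum K) {F : ℕ → Set X} (hF : ∀ i, IsClosed (F i)) (hcov : K ⊆ ⋃ i, F i)
    (hdisj : ∀ x ∈ K, ∀ i j, x ∈ F i → x ∈ F j → i = j) (hns : ∀ i, ¬ K ⊆ F i) (n : ℕ) :
    ∃ L ⊆ K, IsContinuum L ∧ (∀ i, ¬ L ⊆ F i) ∧ Disjoint L (F n) := by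
  obtain ⟨p, hpK, hpn⟩ := not_subset.1 (hns n)
  obtain ⟨m, hpm⟩ := mem_iUnion.1 (hcov hpK)
  have hKc : IsClosed K := hK.1.isClosed
  obtain ⟨U, hU, hmU, hUn⟩ := normal_exists_closure_subset (s := K ∩ F m) (t := (K ∩ F n)ᶜ)
    (hKc.inter (hF m)) (hKc.inter (hF n)).isOpen_compl
    (fun x hx hxn => hpn (hdisj x hx.1 m n hx.2 hxn.2 ▸ hpm))
  have hp : p ∈ K ∩ closure U := ⟨hpK, subset_closure (hmU ⟨hpK, hpm⟩)⟩
  by_cases hKU : K ⊆ closure U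
  · exact ⟨K, Subset.rfl, hK, hns,
      disjoint_left.2 fun x hx hxn => hUn (hKU hx) ⟨hx, hxn⟩⟩
  obtain ⟨z, hzL, hz⟩ := hK.exists_mem_connectedComponentIn_closure_compl isClosed_closure hp hKU
  have hsub := connectedComponentIn_subset (K ∩ closure U) p
  have hzU : z ∉ U := by
    have : closure (closure U)ᶜ ⊆ Uᶜ :=
      closure_minimal (compl_subset_compl.2 subset_closure) hU.isClosed_compl
    exact this hz
  refine ⟨_, hsub.trans inter_subset_left,
    isContinuum_connectedComponentIn (hK.1.inter_right isClosed_closure) hp, ?_, ?_⟩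
  · intro i hi
    have him : i = m := hdisj p hpK i m (hi (mem_connectedComponentIn hp)) hpm
    exact hzU (hmU ⟨(hsub hzL).1, him ▸ hi hzL⟩)
  · exact disjoint_left.2 fun x hx hxn => hUn (hsub hx).2 ⟨(hsub hx).1, hxn⟩

/-- Sierpiński's theorem: a continuum covered by a sequence of closed sets that are pairwise
disjoint on it lies in one of them. -/
theorem IsContinuum.exists_subset_of_iUnion [CompactSpace X] [T2Space X] {K : Set X}
    (hK : IsContinuum K) {F : ℕ → Set X} (hF : ∀ i, IsClosed (F i)) (hcov : K ⊆ ⋃ i, F i)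
    (hdisj : ∀ x ∈ K, ∀ i j, x ∈ F i → x ∈ F j → i = j) : ∃ i, K ⊆ F i := by
  by_contra! hns
  let S := { L : Set X // L ⊆ K ∧ IsContinuum L ∧ ∀ i, ¬ L ⊆ F i }
  have step : ∀ (n : ℕ) (L : S), ∃ M : S, M.1 ⊆ L.1 ∧ Disjoint M.1 (F n) := by
    rintro n ⟨L, hLK, hL, hLF⟩
    obtain ⟨M, hML, hM, hMF, hMn⟩ := hL.exists_subset_disjoint_of_iUnion hF (hLK.trans hcov)
      (fun x hx => hdisj x (hLK hx)) hLF n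
    exact ⟨⟨M, hML.trans hLK, hM, hMF⟩, hML, hMn⟩
  choose g hg hgF using step
  -- `L (n + 1)` misses `F n`, so a point common to all `L n` is uncovered.
  let L : ℕ → S := fun n => Nat.rec ⟨K, Subset.rfl, hK, hns⟩ g n
  obtain ⟨x, hx⟩ := IsCompact.nonempty_iInter_of_sequence_nonempty_isCompact_isClosed
    (fun n => (L n).1) (fun n => hg n (L n)) (fun n => (L n).2.2.1.2.nonempty)
    (L 0).2.2.1.1 (fun n => (L n).2.2.1.1.isClosed)
  rw [mem_iInter] at hx
  obtain ⟨n, hn⟩ := mem_iUnion.1 (hcov (hx 0))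
  exact disjoint_left.1 (hgF n (L n)) (hx (n + 1)) hn

/-- If `K` is a connected subset of a connected space and `P` is an open set disjoint from `K` such
that `K ∪ P` is closed, then `K ∪ P` is connected. -/
theorem IsConnected.union_of_isOpen_of_isClosed [PreconnectedSpace X] {K P : Set X}
    (hK : IsConnected K) (hP : IsOpen P) (hc : IsClosed (K ∪ P)) : IsConnected (K ∪ P) := by
  refine ⟨hK.nonempty.mono subset_union_left, ?_⟩
  have key : ∀ t t' : Set X, IsClosed t → IsClosed t' → K ∪ P ⊆ t ∪ t' →
      (K ∪ P) ∩ (t ∩ t') = ∅ → K ⊆ t → K ∪ P ⊆ t := by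
    intro t t' ht ht' hcov hdisj hKt
    -- As `K ⊆ t`, the part in `t'` lies in `P`, which makes it open as well as closed in `X`.
    have heq : (K ∪ P) ∩ t' = P ∩ tᶜ := by
      ext x
      have h1 := @hcov x
      have h2 : x ∉ (K ∪ P) ∩ (t ∩ t') := by simp [hdisj]
      have h3 := @hKt x
      simp only [mem_union, mem_inter_iff, mem_compl_iff] at *
      tauto
    have hclopen : IsClopen ((K ∪ P) ∩ t') :=
      ⟨hc.inter ht', heq ▸ hP.inter ht.isOpen_compl⟩
    obtain ⟨k, hk⟩ := hK.nonempty
    rcases isClopen_iff.1 hclopen with h | h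
    · intro x hx
      exact (hcov hx).resolve_right fun hx' => (h ▸ ⟨hx, hx'⟩ : x ∈ (∅ : Set X))
    · have : k ∈ P ∩ tᶜ := heq ▸ h ▸ mem_univ k
      exact absurd (hKt hk) this.2
  rw [isPreconnected_iff_subset_of_disjoint_closed]
  intro t t' ht ht' hcov hdisj
  have hKd : K ∩ (t ∩ t') = ∅ :=
    subset_empty_iff.1 (hdisj ▸ inter_subset_inter_left _ subset_union_left)
  rcases isPreconnected_iff_subset_of_disjoint_closed.1 hK.isPreconnected t t' ht ht'
    (subset_union_left.trans hcov) hKd with h | h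
  · exact Or.inl (key t t' ht ht' hcov hdisj h)
  · exact Or.inr (key t' t ht' ht (union_comm t t' ▸ hcov) (inter_comm t t' ▸ hdisj) h)

/-- Otherwise `X` decomposes: into `K` and `closure Kᶜ` if `Kᶜ` is connected, else into `K` joined
with each side of a separation of `Kᶜ`. -/
theorem IsIndecomposable.interior_eq_empty [CompactSpace X] [T2Space X] [ConnectedSpace X]
    (hX : IsIndecomposable X) {K : Set X} (hK : IsContinuum K) (hKu : K ≠ univ) :
    interior K = ∅ := by
  by_contra hint
  obtain ⟨k, hk⟩ := nonempty_iff_ne_empty.2 hint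
  have hKc : IsClosed K := hK.1.isClosed
  by_cases hpre : IsPreconnected Kᶜ
  · refine hX ⟨K, closure Kᶜ, hK, ⟨isClosed_closure.isCompact,
      IsConnected.closure ⟨nonempty_compl.2 hKu, hpre⟩⟩, hKu, ?_, ?_⟩
    · intro h
      rw [closure_compl, compl_univ_iff] at h
      exact hint h
    · exact univ_subset_iff.1 (union_compl_self K ▸ union_subset_union_right K subset_closure)
  · simp only [IsPreconnected, not_forall] at hpre
    obtain ⟨U, V, hU, hV, hcov, hUn, hVn, hUV⟩ := hpre
    have hsplit : ∀ U V : Set X, IsOpen U → IsOpen V → Kᶜ ⊆ U ∪ V → (Kᶜ ∩ V).Nonempty →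
        ¬ (Kᶜ ∩ (U ∩ V)).Nonempty → IsContinuum (K ∪ (Kᶜ ∩ U)) ∧ K ∪ (Kᶜ ∩ U) ≠ univ := by
      intro U V hU hV hcov hVn hUV
      have heq : K ∪ (Kᶜ ∩ U) = (Kᶜ ∩ V)ᶜ := by
        ext x
        have h1 := @hcov x
        have h2 : x ∉ Kᶜ ∩ (U ∩ V) := fun h => hUV ⟨x, h⟩
        simp only [mem_union, mem_inter_iff, mem_compl_iff] at *
        tauto
      have hcl : IsClosed (K ∪ (Kᶜ ∩ U)) := heq ▸ (hKc.isOpen_compl.inter hV).isClosed_compl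
      refine ⟨⟨hcl.isCompact,
        hK.2.union_of_isOpen_of_isClosed (hKc.isOpen_compl.inter hU) hcl⟩, ?_⟩
      rw [heq, Ne, compl_univ_iff]
      exact hVn.ne_empty
    obtain ⟨hA, hAu⟩ := hsplit U V hU hV hcov hVn hUV
    obtain ⟨hB, hBu⟩ := hsplit V U hV hU (union_comm U V ▸ hcov) hUn (inter_comm U V ▸ hUV)
    refine hX ⟨_, _, hA, hB, hAu, hBu, ?_⟩
    ext x
    have h1 := @hcov x
    simp only [mem_union, mem_inter_iff, mem_compl_iff, mem_univ, iff_true] at *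
    tauto

/-- Two points lie in a common proper subcontinuum. -/
def SameComposant (x y : X) : Prop :=
  ∃ K : Set X, IsContinuum K ∧ K ≠ univ ∧ x ∈ K ∧ y ∈ K

theorem SameComposant.symm {x y : X} : SameComposant x y → SameComposant y x :=
  fun ⟨K, hK, hKu, hx, hy⟩ => ⟨K, hK, hKu, hy, hx⟩

theorem IsIndecomposable.sameComposant_trans (hX : IsIndecomposable X) {x y z : X} :
    SameComposant x y → SameComposant y z → SameComposant x z :=
  fun ⟨K, hK, hKu, hx, hy⟩ ⟨L, hL, hLu, hy', hz⟩ =>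
    ⟨K ∪ L, hK.union hL ⟨y, hy, hy'⟩, fun h => hX ⟨K, L, hK, hL, hKu, hLu, h⟩,
      Or.inl hx, Or.inr hz⟩

/-- Composants of a nondegenerate compact connected Hausdorff space are dense. -/
theorem exists_sameComposant_mem [CompactSpace X] [T2Space X] [ConnectedSpace X] [Nontrivial X]
    (p : X) {U : Set X} (hU : IsOpen U) (hUn : U.Nonempty) : ∃ y ∈ U, SameComposant p y := by
  by_cases hpU : p ∈ U
  · refine ⟨p, hpU, {p}, ⟨isCompact_singleton, isConnected_singleton⟩, ?_, rfl, rfl⟩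
    obtain ⟨q, hq⟩ := exists_ne p
    exact fun h => hq (h ▸ mem_univ q : q ∈ ({p} : Set X))
  obtain ⟨u, hu⟩ := hUn
  obtain ⟨V, hV, huV, hVU⟩ := normal_exists_closure_subset (s := {u}) isClosed_singleton hU
    (singleton_subset_iff.2 hu)
  have hpV : p ∈ univ ∩ Vᶜ := ⟨mem_univ p, fun h => hpU (hVU (subset_closure h))⟩
  have huV' : u ∈ V := huV rfl
  -- The component of `p` in `Vᶜ` reaches `closure V ⊆ U` but omits `u`, so it is proper.
  obtain ⟨z, hz, hzV⟩ := IsContinuum.exists_mem_connectedComponentIn_closure_compl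
    ⟨isCompact_univ, isConnected_univ⟩ hV.isClosed_compl hpV (fun h => h (mem_univ u) huV')
  rw [compl_compl] at hzV
  exact ⟨z, hVU hzV, _,
    isContinuum_connectedComponentIn (isCompact_univ.inter_right hV.isClosed_compl) hpV,
    fun h => (connectedComponentIn_subset _ _ (h ▸ mem_univ u)).2 huV',
    mem_connectedComponentIn hpV, hz⟩

/-- Countably many composants of an indecomposable metrizable continuum do not cover it. -/
theorem IsIndecomposable.exists_forall_not_sameComposant [CompactSpace X]
    [TopologicalSpace.MetrizableSpace X] [ConnectedSpace X] (hX : IsIndecomposable X) {S : Set X}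
    (hS : S.Countable) : ∃ q, ∀ p ∈ S, ¬ SameComposant p q := by
  by_contra! hcon
  let _ := TopologicalSpace.metrizableSpaceMetric X
  have := hS.to_subtype
  let b := TopologicalSpace.countableBasis X
  have hb : TopologicalSpace.IsTopologicalBasis b := TopologicalSpace.isBasis_countableBasis X
  have : Countable b := (TopologicalSpace.countable_countableBasis X).to_subtype
  -- A proper subcontinuum through `p` misses some basic open set, so countably many such components
  -- exhaust the composants of points of `S`.
  let C : S × b → Set X := fun i => connectedComponentIn (i.2 : Set X)ᶜ i.1
  have hcpt : ∀ i : S × b, IsCompact (i.2 : Set X)ᶜ :=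
    fun i => (hb.isOpen i.2.2).isClosed_compl.isCompact
  have hclosed : ∀ i, IsClosed (C i) := by
    intro i
    by_cases hi : (i.1 : X) ∈ (i.2 : Set X)ᶜ
    · exact (isContinuum_connectedComponentIn (hcpt i) hi).1.isClosed
    · simp only [C, connectedComponentIn_eq_empty hi, isClosed_empty]
  obtain ⟨i, x, hx⟩ := nonempty_interior_of_iUnion_of_closed hclosed (by
    refine eq_univ_of_forall fun q => ?_
    obtain ⟨p, hpS, K, hK, hKu, hpK, hqK⟩ := hcon q
    obtain ⟨w, hw⟩ := nonempty_compl.2 hKu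
    obtain ⟨U, hUb, hwU, hUK⟩ := hb.exists_subset_of_mem_open hw hK.1.isClosed.isOpen_compl
    exact mem_iUnion.2 ⟨⟨⟨p, hpS⟩, ⟨U, hUb⟩⟩, hK.2.isPreconnected.subset_connectedComponentIn hpK
      (subset_compl_comm.1 hUK) hqK⟩)
  have hi : (i.1 : X) ∈ (i.2 : Set X)ᶜ :=
    connectedComponentIn_nonempty_iff.1 ⟨x, interior_subset hx⟩
  rw [hX.interior_eq_empty (isContinuum_connectedComponentIn (hcpt i) hi)] at hx
  · exact hx
  · intro h
    obtain ⟨w, hw⟩ := TopologicalSpace.nonempty_of_mem_countableBasis i.2.2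
    exact absurd hw (connectedComponentIn_subset (i.2 : Set X)ᶜ i.1 (h ▸ mem_univ w))

/-- Some composant misses a given sequence of proper closed sets with countably many components. -/
theorem IsIndecomposable.exists_composant_disjoint [CompactSpace X]
    [TopologicalSpace.MetrizableSpace X] [ConnectedSpace X] (hX : IsIndecomposable X) {ι : Type*}
    [Countable ι] {F : ι → Set X} (hF : ∀ i, IsClosed (F i)) (hFu : ∀ i, F i ≠ univ)
    (hC : ∀ i, CountablyManyComponents (F i)) :
    ∃ q, ∀ y, SameComposant q y → ∀ i, y ∉ F i := by
  have : ∀ i, Countable (ConnectedComponents (F i)) := hC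
  -- `S` holds one point from each component of each `F i`.
  obtain ⟨q, hq⟩ := hX.exists_forall_not_sameComposant
    (S := ⋃ i, range fun c : ConnectedComponents (F i) => ((Quotient.out c : F i) : X))
    (countable_iUnion fun i => countable_range _)
  refine ⟨q, fun y hy i hyF => ?_⟩
  let c : ConnectedComponents (F i) := ConnectedComponents.mk ⟨y, hyF⟩
  refine hq _ (mem_iUnion.2 ⟨i, c, rfl⟩) (SameComposant.symm (hX.sameComposant_trans hy
    ⟨connectedComponentIn (F i) y, isContinuum_connectedComponentIn (hF i).isCompact hyF,
      fun h => hFu i (univ_subset_iff.1 (h ▸ connectedComponentIn_subset _ _)),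
      mem_connectedComponentIn hyF, ?_⟩))
  rw [connectedComponentIn_eq_image hyF]
  refine mem_image_of_mem _ (ConnectedComponents.coe_eq_coe'.1 ?_)
  exact Quotient.out_eq c

end Continua

theorem theorem3p1 (X : Type u) [TopologicalSpace X] [TopologicalSpace.MetrizableSpace X]
    [CompactSpace X] [ConnectedSpace X] (hX : IsIndecomposable X) :
    IsMazurkiewiczManifold CountablyManyComponents X ∧
      IsStrongCantorManifold CountablyManyComponents X := by
  constructor
  · intro X₀ X₁ _ _ hdisj hX₀ hX₁ F hF
    obtain ⟨a, ha⟩ := hX₀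
    obtain ⟨b, hb⟩ := hX₁
    have : Nontrivial X := ⟨a, b, fun h =>
      disjoint_left.1 hdisj (interior_subset ha) (h ▸ interior_subset hb)⟩
    obtain ⟨q, hq⟩ := hX.exists_composant_disjoint (fun i => (hF i).1) (fun i => (hF i).2.1)
      (fun i => (hF i).2.2)
    obtain ⟨x, hx, hqx⟩ := exists_sameComposant_mem q isOpen_interior ⟨a, ha⟩
    obtain ⟨y, hy, hqy⟩ := exists_sameComposant_mem q isOpen_interior ⟨b, hb⟩
    obtain ⟨K, hK, hKu, hxK, hyK⟩ := hX.sameComposant_trans hqx.symm hqy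
    refine ⟨K, hK, fun z hz hzF => ?_, ⟨x, hxK, interior_subset hx⟩, ⟨y, hyK, interior_subset hy⟩⟩
    obtain ⟨i, hi⟩ := mem_iUnion.1 hzF
    exact hq z (hX.sameComposant_trans hqx ⟨K, hK, hKu, hxK, hz⟩) i hi
  · rintro ⟨F, hF, hcov, hC⟩
    obtain ⟨q, hq⟩ := hX.exists_composant_disjoint (ι := { p : ℕ × ℕ // p.1 ≠ p.2 })
      (F := fun p => F p.1.1 ∩ F p.1.2) (fun p => (hF _).1.inter (hF _).1)
      (fun p h => (hF p.1.1).2 (univ_subset_iff.1 (h ▸ inter_subset_left)))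
      (fun p => hC _ _ p.2)
    have hdisj : ∀ x, SameComposant q x → ∀ i j, x ∈ F i → x ∈ F j → i = j := by
      intro x hx i j hi hj
      by_contra hij
      exact hq x hx ⟨(i, j), hij⟩ ⟨hi, hj⟩
    obtain ⟨i, hi⟩ := mem_iUnion.1 (hcov ▸ mem_univ q)
    obtain ⟨w, hw⟩ := nonempty_compl.2 (hF i).2
    have : Nontrivial X := ⟨q, w, fun h => hw (h ▸ hi)⟩
    obtain ⟨y, hy, K, hK, hKu, hqK, hyK⟩ :=
      exists_sameComposant_mem q (hF i).1.isOpen_compl ⟨w, hw⟩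
    obtain ⟨m, hm⟩ := hK.exists_subset_of_iUnion (fun j => (hF j).1)
      (hcov ▸ subset_univ K) (fun x hx => hdisj x ⟨K, hK, hKu, hqK, hx⟩)
    have hmi : m = i := hdisj q ⟨K, hK, hKu, hqK, hqK⟩ m i (hm hqK) hi
    exact hy (hmi ▸ hm hyK)
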